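/- Let $\mathcal H_1,\dots,\mathcal H_N$ be complex separable Hilbert spaces, possibly infinite-dimensional, let $\rho$ be a state (positive trace class operator of trace one) on $\mathcal H_1\otimes\cdots\otimes\mathcal H_N$, let $S_1,\dots,S_N\ge 1$ be integers and let $\Lambda_1,\dots,\Lambda_N$ be finite non-empty outcome sets, $\Lambda=\Lambda_1\times\cdots\times\Lambda_N$. Maximal Bell violation. For a family $\psi=\{\psi_{(s_1,\dots,s_N)}\}$, $s_n\in\{1,\dots,S_n\}$, of real functions on $\Lambda$, let $\mathcal B_\psi^{\sup}$ and $\mathcal B_\psi^{\inf}$ be the supremum and the infimum of $\sum_{s_1,\dots,s_N}\psi_{(s_1,\dots,s_N)}(\lambda_1^{(s_1)},\dots,\lambda_N^{(s_N)})$ over all $\lambda_n^{(s_n)}\in\Lambda_n$, for all $s_n$ and $n$, and let $\mathcal B_\psi=\max\{|\mathcal B_\psi^{\sup}|,|\mathcal B_\psi^{\inf}|\}$. Define $$\Upsilon^{(\rho,\Lambda)}_{S_1\times\cdots\times S_N}=\sup\ \frac1{\mathcal B_\psi}\Big|\sum_{s_1,\dots,s_N}\ \sum_{\lambda\in\Lambda}\psi_{(s_1,\dots,s_N)}(\lambda)\,\mathrm{tr}\big[\rho\{\mathrm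 M_1^{(s_1)}(\lambda_1)\otimes\cdots\otimes \mathrm M_N^{(s_N)}(\lambda_N)\}\big]\Big| ,$$ where the supremum is over all POV measures $\mathrm M_n^{(s_n)}$ on $\mathcal H_n$ with outcomes in $\Lambda_n$ and all $\psi$ with $\mathcal B_\psi\neq0$. Source operators. For integers $R_1,\dots,R_N\ge1$, an $R_1\times\cdots\times R_N$-setting source operator for $\rho$ is a self-adjoint trace class operator $T$ on $\mathcal H_1^{\otimes R_1}\otimes\cdots\otimes\mathcal H_N^{\otimes R_N}$ that is a dilation of $\rho$: for every choice of one copy of $\mathcal H_n$ at each site $n$ and all bounded operators $X_n$ on $\mathcal H_n$, one has $\mathrm{tr}[T\widetilde X]=\mathrm{tr}[\rho\{X_1\otimes\cdots\otimes X_N\}]$, where $\widetilde X$ is the tensor product operator that acts as $X_n$ on the chosen copies and as the identity on the others. Covering norm. A trace class operator $V$ on $\mathcal G_1\otimes\cdots\otimes\mathcal G_m$ is tensor positive if $\mathrm{tr}[V\{X_1\otimes\cdots\otimes X_m\}]\ge0$ for all positive bounded operators $X_j$ on $\mathcal G_j$. For a self-adjoint trace class operator $W$ let $\|W\|_{cov}$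 be the infimum of $\mathrm{tr}[V]$ over all tensor positive trace class $V$ such that $V+W$ and $V-W$ are tensor positive. For source operators the tensor factors are all the $R_1+\cdots+R_N$ copies. Theorem 2. Then $$1\ \le\ \Upsilon^{(\rho,\Lambda)}_{S_1\times\cdots\times S_N}\ \le\ \inf_{n,\,T}\ \|T\|_{cov},$$ where the infimum is over all $n\in\{1,\dots,N\}$ and all $S_1\times\cdots\times S_{n-1}\times1\times S_{n+1}\times\cdots\times S_N$-setting source operators $T$ for $\rho$. -/

import Mathlib

open scoped ComplexOrder TensorProduct Matrix ENNReal

universe u v w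

noncomputable section

namespace Bell

/-! ### The Hilbert space tensor product of a finite family of complex inner product spaces

It is the completion of the algebraic tensor product with respect to the inner product determined
by `⟪⊗ x i, ⊗ y i⟫ = ∏ i, ⟪x i, y i⟫`. -/

section Tensor

variable {ι : Type w}
variable {E : ι → Type u} [∀ i, NormedAddCommGroup (E i)] [∀ i, InnerProductSpace ℂ (E i)]
variable {F : ι → Type v} [∀ i, NormedAddCommGroup (F i)] [∀ i, InnerProductSpace ℂ (F i)]

variable (E) in
/-- The algebraic tensor product `⨂ i, E i`. It is a type synonym of Mathlib's `PiTensorProduct`,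
which carries the projective seminorm instead of the Hilbert space norm. -/
def AlgTensor : Type (max w u) := PiTensorProduct ℂ E

instance : AddCommGroup (AlgTensor E) := inferInstanceAs (AddCommGroup (PiTensorProduct ℂ E))

instance : Module ℂ (AlgTensor E) := inferInstanceAs (Module ℂ (PiTensorProduct ℂ E))

/-- The elementary tensor `⊗ x i` in the algebraic tensor product. -/
def algTprod (x : ∀ i, E i) : AlgTensor E := PiTensorProduct.tprod ℂ x

/-- The algebraic tensor product of linear maps. -/
def algMap (X : ∀ i, E i →L[ℂ] F i) : AlgTensor E →ₗ[ℂ] AlgTensor F :=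
  PiTensorProduct.map fun i => (X i).toLinearMap

theorem algMap_algTprod (X : ∀ i, E i →L[ℂ] F i) (x : ∀ i, E i) :
    algMap X (algTprod x) = algTprod fun i => X i (x i) :=
  PiTensorProduct.map_tprod _ _

theorem algTensor_hom_ext {f g : AlgTensor E →ₗ[ℂ] ℂ}
    (h : ∀ y : ∀ i, E i, f (algTprod y) = g (algTprod y)) : f = g :=
  PiTensorProduct.ext (MultilinearMap.ext h)

theorem exists_eq_sum_algTprod (z : AlgTensor E) :
    ∃ (m : ℕ) (c : Fin m → ℂ) (x : Fin m → ∀ i, E i), z = ∑ k, c k • algTprod (x k) := by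
  have h : ∀ z : PiTensorProduct ℂ E, ∃ (m : ℕ) (c : Fin m → ℂ) (x : Fin m → ∀ i, E i),
      z = ∑ k, c k • PiTensorProduct.tprod ℂ (x k) := by
    intro z
    have hz : z ∈ Submodule.span ℂ (Set.range (PiTensorProduct.tprod ℂ (s := E))) := by
      rw [PiTensorProduct.span_tprod_eq_top]
      trivial
    obtain ⟨m, c, g, rfl⟩ := Submodule.mem_span_set'.1 hz
    choose x hx using fun k => (g k).2
    exact ⟨m, c, x, Finset.sum_congr rfl fun k _ => by rw [hx k]⟩
  exact h z

/-- Entrywise products of positive semidefinite matrices are monotone. -/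
theorem posSemidef_prod_sub_prod {κ : Type*} [Fintype κ] (s : Finset ι)
    (A B : ι → Matrix κ κ ℂ) (hA : ∀ i, (A i).PosSemidef) (hAB : ∀ i, (B i - A i).PosSemidef) :
    (Matrix.of fun k l => ∏ i ∈ s, A i k l).PosSemidef ∧
      (Matrix.of fun k l => ∏ i ∈ s, B i k l).PosSemidef ∧
      ((Matrix.of fun k l => ∏ i ∈ s, B i k l) -
        Matrix.of fun k l => ∏ i ∈ s, A i k l).PosSemidef := by
  classical
  have hB : ∀ i, (B i).PosSemidef := fun i => by
    have := (hAB i).add (hA i)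
    rwa [sub_add_cancel] at this
  induction s using Finset.induction_on with
  | empty =>
    have h1 : (Matrix.of fun _ _ : κ => (1 : ℂ)).PosSemidef := by
      have := Matrix.posSemidef_gram ℂ (fun _ : κ => (1 : ℂ))
      have e : (Matrix.of fun _ _ : κ => (1 : ℂ)) = Matrix.gram ℂ (fun _ : κ => (1 : ℂ)) := by
        ext k l
        simp
      rw [e]
      exact this
    simpa using ⟨h1, Matrix.PosSemidef.zero⟩
  | insert a s ha ih =>
    obtain ⟨h1, h2, h3⟩ := ih
    refine ⟨?_, ?_, ?_⟩
    · have e : (Matrix.of fun k l => ∏ i ∈ insert a s, A i k l) =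
          A a ⊙ Matrix.of fun k l => ∏ i ∈ s, A i k l := by
        ext k l
        simp [Finset.prod_insert ha]
      rw [e]
      exact (hA a).hadamard h1
    · have e : (Matrix.of fun k l => ∏ i ∈ insert a s, B i k l) =
          B a ⊙ Matrix.of fun k l => ∏ i ∈ s, B i k l := by
        ext k l
        simp [Finset.prod_insert ha]
      rw [e]
      exact (hB a).hadamard h2
    · have e : ((Matrix.of fun k l => ∏ i ∈ insert a s, B i k l) -
            Matrix.of fun k l => ∏ i ∈ insert a s, A i k l) =
          ((B a - A a) ⊙ Matrix.of fun k l => ∏ i ∈ s, B i k l) +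
            A a ⊙ ((Matrix.of fun k l => ∏ i ∈ s, B i k l) -
              Matrix.of fun k l => ∏ i ∈ s, A i k l) := by
        ext k l
        simp [Finset.prod_insert ha]
        ring
      rw [e]
      exact ((hAB a).hadamard h2).add ((hA a).hadamard h3)

variable [Fintype ι]

/-- The linear functional `y ↦ ⟪⊗ x i, y⟫`. -/
def algInnerAux (x : ∀ i, E i) : AlgTensor E →ₗ[ℂ] ℂ :=
  PiTensorProduct.lift
    ((MultilinearMap.mkPiAlgebra ℂ ι ℂ).compLinearMap fun i => innerₛₗ ℂ (x i))

theorem algInnerAux_algTprod (x y : ∀ i, E i) :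
    algInnerAux x (algTprod y) = ∏ i, inner ℂ (x i) (y i) := by
  refine (PiTensorProduct.lift.tprod (R := ℂ) y).trans ?_
  simp

/-- The sesquilinear form with `algForm (⊗ x i) (⊗ y i) = ∏ i, ⟪y i, x i⟫`. -/
def algForm : AlgTensor E →ₗ[ℂ] (AlgTensor E →ₗ⋆[ℂ] ℂ) :=
  PiTensorProduct.lift
    { toFun := fun x =>
        (starLinearEquiv ℂ : ℂ ≃ₗ⋆[ℂ] ℂ).toLinearMap.comp (algInnerAux x)
      map_update_add' := by
        intro _ x i a b
        have h : algInnerAux (Function.update x i (a + b)) =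
            algInnerAux (Function.update x i a) + algInnerAux (Function.update x i b) := by
          refine algTensor_hom_ext fun y => ?_
          simp only [LinearMap.add_apply, algInnerAux_algTprod]
          rw [Fintype.prod_eq_mul_prod_compl i, Fintype.prod_eq_mul_prod_compl i,
            Fintype.prod_eq_mul_prod_compl i]
          have e : ∀ c : E i, ∏ j ∈ ({i} : Finset ι)ᶜ, inner ℂ (Function.update x i c j) (y j) =
              ∏ j ∈ ({i} : Finset ι)ᶜ, inner ℂ (x j) (y j) := fun c =>
            Finset.prod_congr rfl fun j hj => by
              rw [Function.update_of_ne (by simpa using hj)]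
          rw [e, e, e]
          simp only [Function.update_self, inner_add_left, add_mul]
        rw [h]
        ext y
        simp
      map_update_smul' := by
        intro _ x i c a
        have h : algInnerAux (Function.update x i (c • a)) =
            (starRingEnd ℂ c) • algInnerAux (Function.update x i a) := by
          refine algTensor_hom_ext fun y => ?_
          simp only [LinearMap.smul_apply, algInnerAux_algTprod]
          rw [Fintype.prod_eq_mul_prod_compl i, Fintype.prod_eq_mul_prod_compl i]
          have e : ∀ c : E i, ∏ j ∈ ({i} : Finset ι)ᶜ, inner ℂ (Function.update x i c j) (y j) =
              ∏ j ∈ ({i} : Finset ι)ᶜ, inner ℂ (x j) (y j) := fun c =>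
            Finset.prod_congr rfl fun j hj => by
              rw [Function.update_of_ne (by simpa using hj)]
          rw [e, e]
          simp only [Function.update_self, inner_smul_left, mul_assoc, smul_eq_mul]
        rw [h]
        ext y
        simp }

theorem algForm_algTprod (x y : ∀ i, E i) :
    algForm (algTprod x) (algTprod y) = ∏ i, inner ℂ (y i) (x i) := by
  have h : algForm (algTprod x) (algTprod y) = star (algInnerAux x (algTprod y)) := by
    refine (congrArg (fun f : AlgTensor E →ₗ⋆[ℂ] ℂ => f (algTprod y))
      (PiTensorProduct.lift.tprod (R := ℂ) x)).trans ?_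
    rfl
  rw [h, algInnerAux_algTprod]
  simp [star_prod]

theorem algForm_sum {m : ℕ} (c : Fin m → ℂ) (x : Fin m → ∀ i, E i) :
    algForm (∑ k, c k • algTprod (x k)) (∑ k, c k • algTprod (x k)) =
      star c ⬝ᵥ (Matrix.of fun k l => ∏ i, Matrix.gram ℂ (fun k => x k i) k l) *ᵥ c := by
  simp only [map_sum, map_smul, LinearMap.sum_apply, LinearMap.smul_apply, map_smulₛₗ,
    algForm_algTprod, dotProduct, Matrix.mulVec, Matrix.of_apply, Matrix.gram_apply, smul_eq_mul,
    Finset.mul_sum, Pi.star_apply, RCLike.star_def]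
  exact Finset.sum_congr rfl fun k _ => Finset.sum_congr rfl fun l _ => by ring

theorem algForm_self_nonneg (z : AlgTensor E) : 0 ≤ algForm z z := by
  obtain ⟨m, c, x, rfl⟩ := exists_eq_sum_algTprod z
  rw [algForm_sum]
  exact (posSemidef_prod_sub_prod Finset.univ (fun i => Matrix.gram ℂ (fun k => x k i))
    (fun i => Matrix.gram ℂ (fun k => x k i)) (fun i => Matrix.posSemidef_gram ℂ _)
    (fun i => by simpa using Matrix.PosSemidef.zero)).1.dotProduct_mulVec_nonneg c

theorem algForm_conj (y z : AlgTensor E) : starRingEnd ℂ (algForm y z) = algForm z y := by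
  obtain ⟨m, c, x, rfl⟩ := exists_eq_sum_algTprod y
  obtain ⟨m', c', x', rfl⟩ := exists_eq_sum_algTprod z
  simp only [map_sum, map_smul, LinearMap.sum_apply, LinearMap.smul_apply, map_smulₛₗ,
    algForm_algTprod, smul_eq_mul, Finset.mul_sum, map_mul, map_prod, inner_conj_symm,
    Complex.conj_conj]
  rw [Finset.sum_comm]
  exact Finset.sum_congr rfl fun k _ => Finset.sum_congr rfl fun l _ => by ring

/-- The (semi-)inner product `⟪⊗ x i, ⊗ y i⟫ = ∏ i, ⟪x i, y i⟫`. -/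
@[reducible]
def algCore : PreInnerProductSpace.Core ℂ (AlgTensor E) where
  inner x y := algForm y x
  conj_inner_symm x y := algForm_conj x y
  re_inner_nonneg x := (Complex.nonneg_iff.1 (algForm_self_nonneg x)).1
  add_left x y z := by simp
  smul_left x y r := by simp

instance : SeminormedAddCommGroup (AlgTensor E) :=
  letI := algCore (E := E)
  InnerProductSpace.Core.toSeminormedAddCommGroup (𝕜 := ℂ)

instance : InnerProductSpace ℂ (AlgTensor E) := InnerProductSpace.ofCore algCore

theorem inner_algTprod (x y : ∀ i, E i) :
    inner ℂ (algTprod x) (algTprod y) = ∏ i, inner ℂ (x i) (y i) :=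
  algForm_algTprod y x

theorem algTensor_norm_sq (z : AlgTensor E) : ‖z‖ ^ 2 = (algForm z z).re :=
  norm_sq_eq_re_inner (𝕜 := ℂ) z

theorem norm_algMap_le (X : ∀ i, E i →L[ℂ] F i) (z : AlgTensor E) :
    ‖algMap X z‖ ≤ (∏ i, ‖X i‖) * ‖z‖ := by
  have hP : 0 ≤ ∏ i, ‖X i‖ := Finset.prod_nonneg fun i _ => norm_nonneg _
  refine le_of_sq_le_sq ?_ (mul_nonneg hP (norm_nonneg _))
  rw [mul_pow, algTensor_norm_sq, algTensor_norm_sq]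
  obtain ⟨m, c, x, rfl⟩ := exists_eq_sum_algTprod z
  have hm : algMap X (∑ k, c k • algTprod (x k)) =
      ∑ k, c k • algTprod (fun i => X i (x k i)) := by
    simp [algMap_algTprod]
  rw [hm, algForm_sum, algForm_sum]
  have h := (posSemidef_prod_sub_prod Finset.univ
    (fun i => Matrix.gram ℂ (fun k => X i (x k i)))
    (fun i => ‖X i‖ ^ 2 • Matrix.gram ℂ (fun k => x k i)) (fun i => Matrix.posSemidef_gram ℂ _)
    (fun i => Matrix.posSemidef_opNorm_smul_gram_sub_gram (fun k => x k i) (X i))).2.2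
  have h0 := (Complex.nonneg_iff.1 (h.dotProduct_mulVec_nonneg c)).1
  have e : (Matrix.of fun k l => ∏ i, (‖X i‖ ^ 2 • Matrix.gram ℂ (fun k => x k i)) k l) =
      ((∏ i, ‖X i‖) ^ 2) • Matrix.of fun k l => ∏ i, Matrix.gram ℂ (fun k => x k i) k l := by
    ext k l
    simp [Finset.prod_mul_distrib, Finset.prod_pow]
  rw [e, Matrix.sub_mulVec, dotProduct_sub, Complex.sub_re, Matrix.smul_mulVec,
    dotProduct_smul, Complex.smul_re, smul_eq_mul] at h0
  linarith

variable (E) in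
/-- The Hilbert space tensor product `⨂ i, E i`: the completion of the algebraic one. -/
abbrev HilbertTensor : Type (max w u) := UniformSpace.Completion (AlgTensor E)

/-- The elementary tensor `⊗ x i`. -/
def elemTensor (x : ∀ i, E i) : HilbertTensor E := (algTprod x : AlgTensor E)

theorem inner_elemTensor (x y : ∀ i, E i) :
    inner ℂ (elemTensor x) (elemTensor y) = ∏ i, inner ℂ (x i) (y i) := by
  rw [elemTensor, elemTensor, UniformSpace.Completion.inner_coe, inner_algTprod]

/-- The tensor product `⨂ i, X i` of bounded operators: the bounded operator with
`(⨂ i, X i) (⊗ x i) = ⊗ (X i x i)`. -/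
def opTensor (X : ∀ i, E i →L[ℂ] F i) : HilbertTensor E →L[ℂ] HilbertTensor F :=
  ((algMap X).mkContinuous (∏ i, ‖X i‖) (norm_algMap_le X)).completion

theorem opTensor_elemTensor (X : ∀ i, E i →L[ℂ] F i) (x : ∀ i, E i) :
    opTensor X (elemTensor x) = elemTensor fun i => X i (x i) := by
  simp [opTensor, elemTensor, algMap_algTprod]

end Tensor

/-! ### Trace class operators and the trace -/

section TraceClass

variable {K : Type u} [NormedAddCommGroup K] [InnerProductSpace ℂ K]

/-- Trace class (nuclear) operators on a Hilbert space: norm-convergent sums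
`∑ k, |x k⟩⟨y k|` with `∑ k, ‖x k‖ ‖y k‖ < ∞`. -/
def IsTraceClass (W : K →L[ℂ] K) : Prop :=
  ∃ x y : ℕ → K, (Summable fun k => ‖x k‖ * ‖y k‖) ∧
    ∀ z, HasSum (fun k => inner ℂ (y k) z • x k) (W z)

/-- For a trace class operator the sum of the diagonal matrix elements converges in every
orthonormal basis, to a value that does not depend on the basis. -/
theorem hasSum_inner_of_isTraceClass {κ : Type*} (b : HilbertBasis κ ℂ K) {W : K →L[ℂ] K}
    {x y : ℕ → K} (hs : Summable fun k => ‖x k‖ * ‖y k‖)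
    (hW : ∀ z, HasSum (fun k => inner ℂ (y k) z • x k) (W z)) :
    HasSum (fun i => inner ℂ (b i) (W (b i))) (∑' k, inner ℂ (y k) (x k)) := by
  have hb : ∀ k, Summable fun i => ‖inner ℂ (y k) (b i) * inner ℂ (b i) (x k)‖ := fun k =>
    (b.summable_inner_mul_inner (y k) (x k)).norm
  have hsq : ∀ z, Summable fun i => ‖inner ℂ (b i) z‖ ^ 2 := fun z => by
    exact b.orthonormal.inner_products_summable z
  have hle : ∀ k, ∑' i, ‖inner ℂ (y k) (b i) * inner ℂ (b i) (x k)‖ ≤ ‖x k‖ * ‖y k‖ := by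
    intro k
    refine (hb k).tsum_le_of_sum_le fun s => ?_
    have h1 : ∀ z, ∑ i ∈ s, ‖inner ℂ (b i) z‖ ^ 2 ≤ ‖z‖ ^ 2 := fun z =>
      b.orthonormal.sum_inner_products_le z
    have h2 := Finset.sum_mul_sq_le_sq_mul_sq s (fun i => ‖inner ℂ (b i) (y k)‖)
      fun i => ‖inner ℂ (b i) (x k)‖
    have h3 : ∑ i ∈ s, ‖inner ℂ (y k) (b i) * inner ℂ (b i) (x k)‖ =
        ∑ i ∈ s, ‖inner ℂ (b i) (y k)‖ * ‖inner ℂ (b i) (x k)‖ :=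
      Finset.sum_congr rfl fun i _ => by rw [norm_mul, norm_inner_symm]
    rw [h3]
    refine le_of_sq_le_sq (h2.trans ?_) (by positivity)
    rw [mul_pow, mul_comm]
    exact mul_le_mul (h1 _) (h1 _) (Finset.sum_nonneg fun _ _ => by positivity) (by positivity)
  have hsum : Summable fun p : ℕ × κ => inner ℂ (y p.1) (b p.2) * inner ℂ (b p.2) (x p.1) := by
    refine Summable.of_norm ((summable_prod_of_nonneg fun _ => norm_nonneg _).2 ⟨hb, ?_⟩)
    exact Summable.of_nonneg_of_le (fun k => tsum_nonneg fun _ => norm_nonneg _) hle hs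
  have hrow : ∀ i, HasSum (fun k => inner ℂ (y k) (b i) * inner ℂ (b i) (x k))
      (inner ℂ (b i) (W (b i))) := by
    intro i
    have := (innerSL ℂ (b i)).hasSum (hW (b i))
    simpa [inner_smul_right] using this
  have hcol : ∀ k, HasSum (fun i => inner ℂ (y k) (b i) * inner ℂ (b i) (x k))
      (inner ℂ (y k) (x k)) := fun k => b.hasSum_inner_mul_inner (y k) (x k)
  have ht := hsum.hasSum
  have hc := ht.prod_fiberwise hcol
  have hr := ((Equiv.prodComm κ ℕ).hasSum_iff.2 ht).prod_fiberwise hrow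
  rwa [← hc.tsum_eq] at hr

variable [CompleteSpace K]

/-- The trace `∑ i, ⟪b i, W b i⟫` of a trace class operator, in an orthonormal basis `b`. -/
def trace (W : K →L[ℂ] K) : ℂ :=
  let b := (exists_hilbertBasis ℂ K).choose_spec.choose
  ∑' i, inner ℂ (b i) (W (b i))

end TraceClass

/-! ### Tensor positivity, the covering norm, states and source operators -/

section Covering

variable {ι : Type w} [Fintype ι]
variable {G : ι → Type u} [∀ i, NormedAddCommGroup (G i)] [∀ i, InnerProductSpace ℂ (G i)]
  [∀ i, CompleteSpace (G i)]

/-- `W` is a tensor positive trace class operator on `⨂ i, G i`: it is trace class and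
`tr[W (⨂ i, X i)] ≥ 0` for all positive bounded operators `X i` on the factors. -/
def IsTensorPositive (W : HilbertTensor G →L[ℂ] HilbertTensor G) : Prop :=
  IsTraceClass W ∧
    ∀ X : ∀ i, G i →L[ℂ] G i, (∀ i, (X i).IsPositive) → 0 ≤ trace (W ∘L opTensor X)

/-- `V` is a trace class covering of `W`. -/
def IsCovering (W V : HilbertTensor G →L[ℂ] HilbertTensor G) : Prop :=
  IsTensorPositive V ∧ IsTensorPositive (V + W) ∧ IsTensorPositive (V - W)

/-- The covering norm of a self-adjoint trace class operator: the infimum of the traces of its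
trace class coverings. -/
def coveringNorm (W : HilbertTensor G →L[ℂ] HilbertTensor G) : ℝ :=
  sInf {r : ℝ | ∃ V, IsCovering W V ∧ r = (trace V).re}

/-- `ρ` is a state (density operator): a positive trace class operator of trace one. -/
def IsState {K : Type u} [NormedAddCommGroup K] [InnerProductSpace ℂ K] [CompleteSpace K]
    (ρ : K →L[ℂ] K) : Prop :=
  ρ.IsPositive ∧ IsTraceClass ρ ∧ trace ρ = 1

end Covering

section Scenario

variable {N : ℕ} {H : Fin N → Type u} [∀ n, NormedAddCommGroup (H n)]
  [∀ n, InnerProductSpace ℂ (H n)] [∀ n, CompleteSpace (H n)]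

variable (H) in
/-- The space `H 1 ^ ⊗ S 1 ⊗ ⋯ ⊗ H N ^ ⊗ S N`, the tensor product of `S n` copies of each `H n`. -/
abbrev CopiesTensor (S : Fin N → ℕ) : Type u :=
  HilbertTensor fun i : (n : Fin N) × Fin (S n) => H i.1

/-- `T` is an `S 1 × ⋯ × S N`-setting source operator for `ρ`: a self-adjoint trace class operator
on the space of copies that dilates `ρ`. That is, whichever copy `k n` of `H n` is selected at each
site `n`, the operator `T` reduces to `ρ` on the selected copies. -/
structure IsSourceOperator (ρ : HilbertTensor H →L[ℂ] HilbertTensor H) (S : Fin N → ℕ)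
    (T : CopiesTensor H S →L[ℂ] CopiesTensor H S) : Prop where
  isSelfAdjoint : IsSelfAdjoint T
  isTraceClass : IsTraceClass T
  trace_eq : ∀ (k : ∀ n, Fin (S n)) (X : ∀ n, H n →L[ℂ] H n),
    trace (T ∘L opTensor fun i : (n : Fin N) × Fin (S n) => if i.2 = k i.1 then X i.1 else 1) =
      trace (ρ ∘L opTensor X)

/-- POV measures on `E` with outcomes in a finite set `L`. -/
structure POVM (E : Type u) [NormedAddCommGroup E] [InnerProductSpace ℂ E] [CompleteSpace E]
    (L : Type v) [Fintype L] where
  /-- The operator of an outcome. -/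
  effect : L → E →L[ℂ] E
  isPositive : ∀ l, (effect l).IsPositive
  sum_effect : ∑ l, effect l = 1

variable {S : Fin N → ℕ} {Λ : Fin N → Type v} [∀ n, Fintype (Λ n)]

/-- The joint probability `tr[ρ (M_1^{(s_1)}(l_1) ⊗ ⋯ ⊗ M_N^{(s_N)}(l_N))]` of the outcomes `l`
under the joint measurement `s` of the quantum correlation scenario given by `ρ` and `M`. -/
def jointProb (ρ : HilbertTensor H →L[ℂ] HilbertTensor H)
    (M : ∀ n, Fin (S n) → POVM (H n) (Λ n)) (s : ∀ n, Fin (S n)) (l : ∀ n, Λ n) : ℝ :=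
  (trace (ρ ∘L opTensor fun n => (M n (s n)).effect (l n))).re

/-- The linear combination `∑ s, ⟨ψ s⟩` of averages in the quantum scenario given by `ρ`, `M`. -/
def quantumValue (ρ : HilbertTensor H →L[ℂ] HilbertTensor H)
    (M : ∀ n, Fin (S n) → POVM (H n) (Λ n)) (ψ : (∀ n, Fin (S n)) → (∀ n, Λ n) → ℝ) : ℝ :=
  ∑ s, ∑ l, ψ s l * jointProb ρ M s l

/-- The upper LHV constant: the supremum of `∑ s, ψ s (l_1^{(s_1)}, …, l_N^{(s_N)})` over all
choices of outcomes `l_n^{(s_n)}` for all measurements. -/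
def lhvSup (ψ : (∀ n, Fin (S n)) → (∀ n, Λ n) → ℝ) : ℝ :=
  ⨆ l : ∀ n, Fin (S n) → Λ n, ∑ s, ψ s fun n => l n (s n)

/-- The lower LHV constant. -/
def lhvInf (ψ : (∀ n, Fin (S n)) → (∀ n, Λ n) → ℝ) : ℝ :=
  ⨅ l : ∀ n, Fin (S n) → Λ n, ∑ s, ψ s fun n => l n (s n)

/-- The larger absolute value of the two LHV constants. -/
def lhvBound (ψ : (∀ n, Fin (S n)) → (∀ n, Λ n) → ℝ) : ℝ :=
  max |lhvSup ψ| |lhvInf ψ|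

/-- The maximal `S 1 × ⋯ × S N`-setting Bell violation for the state `ρ` and outcomes in
`Λ 1 × ⋯ × Λ N`: the supremum, in `[0, ∞]`, of `|∑ s, ⟨ψ s⟩| / lhvBound ψ` over all quantum
scenarios on `ρ` and all families `ψ` of real functions for which the ratio is defined. -/
def maxBellViolation (ρ : HilbertTensor H →L[ℂ] HilbertTensor H) (S : Fin N → ℕ)
    (Λ : Fin N → Type v) [∀ n, Fintype (Λ n)] : ℝ≥0∞ :=
  ⨆ (M : ∀ n, Fin (S n) → POVM (H n) (Λ n)) (ψ : (∀ n, Fin (S n)) → (∀ n, Λ n) → ℝ)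
    (_ : lhvBound ψ ≠ 0), ENNReal.ofReal (|quantumValue ρ M ψ| / lhvBound ψ)

end Scenario

end Bell

end

open Bell

namespace Bell

/-! ### Tensor products of bounded operators. -/

section OpTensor

variable {ι : Type w} [Fintype ι]
variable {E : ι → Type u} [∀ i, NormedAddCommGroup (E i)] [∀ i, InnerProductSpace ℂ (E i)]

/-! The lower bound comes from `ψ = 1`: joint probabilities sum to one, so the quantum value and the
LHV constant both equal the number of joint settings.

For the upper bound, let `T` be a source operator with one copy at site `n`, and `V` a covering of
`T`. For each setting `t` at site `n`, measure setting `t` on the single copy there, and at every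
other site measure setting `r` on copy number `r`. By the dilation property (`sum_mul_jointProb`),
`T` then gives a real quasi-distribution of all outcomes which reproduces the quantum probabilities
of every joint setting containing `t`. It may be negative, but `T = ((V + T) - (V - T)) / 2`, and
both tensor positive terms give nonnegative weights. For each of them the marginal on the sites
other than `n` does not depend on `t`, because the effects at site `n` sum to the identity
(`sum_copyProb_update`).

Such a family obeys the LHV bounds up to its total mass (`sum_mul_le_of_marginal_eq`): with the
outcomes away from `n` fixed, the best reply to each `t` completes them to a deterministic local
strategy. The masses `tr (V + T)` and `tr (V - T)` add up to `2 tr V`, whence the bound `tr V` on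
the violation.

Passing to the infimum over `V` requires some covering to exist; `exists_isCovering` builds one by
polarizing a rank-one expansion of `T`. -/

theorem opTensor_coe (X : ∀ i, E i →L[ℂ] E i) (z : AlgTensor E) :
    opTensor X (z : HilbertTensor E) = (algMap X z : AlgTensor E) := by
  simp [opTensor]

theorem hilbertTensor_clm_ext {A B : HilbertTensor E →L[ℂ] HilbertTensor E}
    (h : ∀ z : AlgTensor E, A (z : HilbertTensor E) = B (z : HilbertTensor E)) : A = B := by
  ext x
  induction x using UniformSpace.Completion.induction_on with
  | hp => exact isClosed_eq A.continuous B.continuous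
  | ih z => exact h z

theorem opTensor_one : opTensor (fun i => (1 : E i →L[ℂ] E i)) = 1 := by
  refine hilbertTensor_clm_ext fun z => ?_
  have h : algMap (fun i => (1 : E i →L[ℂ] E i)) = LinearMap.id := PiTensorProduct.map_id
  rw [opTensor_coe, h]
  rfl

theorem opTensor_update_add [DecidableEq ι] (X : ∀ i, E i →L[ℂ] E i) (i : ι)
    (A B : E i →L[ℂ] E i) :
    opTensor (Function.update X i (A + B)) =
      opTensor (Function.update X i A) + opTensor (Function.update X i B) := by
  refine hilbertTensor_clm_ext fun z => ?_
  have hu : ∀ C : E i →L[ℂ] E i, (fun j => ((Function.update X i C) j).toLinearMap) =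
      Function.update (fun j => (X j).toLinearMap) i C.toLinearMap := fun C => by
    ext1 j
    by_cases h : j = i
    · subst h; simp
    · simp [h]
  have h : algMap (Function.update X i (A + B)) =
      algMap (Function.update X i A) + algMap (Function.update X i B) := by
    unfold algMap
    rw [hu, hu, hu, ContinuousLinearMap.toLinearMap_add]
    exact PiTensorProduct.map_update_add _ _ _ _
  simp only [add_apply, opTensor_coe, h, LinearMap.add_apply]
  exact UniformSpace.Completion.coe_add _ _

theorem opTensor_update_smul [DecidableEq ι] (X : ∀ i, E i →L[ℂ] E i) (i : ι) (c : ℂ)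
    (A : E i →L[ℂ] E i) :
    opTensor (Function.update X i (c • A)) = c • opTensor (Function.update X i A) := by
  refine hilbertTensor_clm_ext fun z => ?_
  have hu : ∀ C : E i →L[ℂ] E i, (fun j => ((Function.update X i C) j).toLinearMap) =
      Function.update (fun j => (X j).toLinearMap) i C.toLinearMap := fun C => by
    ext1 j
    by_cases h : j = i
    · subst h; simp
    · simp [h]
  have h : algMap (Function.update X i (c • A)) = c • algMap (Function.update X i A) := by
    unfold algMap
    rw [hu, hu, ContinuousLinearMap.toLinearMap_smul]
    exact PiTensorProduct.map_update_smul _ _ _ _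
  simp only [smul_apply, opTensor_coe, h, LinearMap.smul_apply]
  exact UniformSpace.Completion.coe_smul _ _

/-- On a finite sum of elementary tensors the quadratic form is that of an entrywise product of
positive semidefinite matrices, so the Schur product theorem applies; density gives the rest. -/
theorem inner_opTensor_self_nonneg [∀ i, CompleteSpace (E i)] (X : ∀ i, E i →L[ℂ] E i)
    (hX : ∀ i, (X i).IsPositive) (z : HilbertTensor E) : 0 ≤ inner ℂ z (opTensor X z) := by
  induction z using UniformSpace.Completion.induction_on with
  | hp =>
    exact isClosed_le continuous_const (continuous_id.inner (opTensor X).continuous)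
  | ih z =>
    rw [opTensor_coe, UniformSpace.Completion.inner_coe]
    obtain ⟨m, c, x, rfl⟩ := exists_eq_sum_algTprod z
    have hpos : ∀ i, (Matrix.of fun k l => inner ℂ (x k i) (X i (x l i))).PosSemidef := by
      intro i
      refine Matrix.PosSemidef.of_dotProduct_mulVec_nonneg ?_ fun c => ?_
      · ext k l
        simp only [Matrix.conjTranspose_apply, Matrix.of_apply, RCLike.star_def, inner_conj_symm]
        exact (hX i).isSymmetric _ _
      · have h := (hX i).inner_nonneg_right (∑ k, c k • x k i)
        convert h using 1
        simp only [map_sum, map_smul, sum_inner, inner_sum, inner_smul_left, inner_smul_right,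
          dotProduct, Matrix.mulVec, Matrix.of_apply, Pi.star_apply, RCLike.star_def,
          Finset.mul_sum]
        rw [Finset.sum_comm]
        exact Finset.sum_congr rfl fun k _ => Finset.sum_congr rfl fun l _ => by ring
    have h := (posSemidef_prod_sub_prod Finset.univ _
      (fun i => Matrix.of fun k l => inner ℂ (x k i) (X i (x l i))) hpos (fun i => by simpa using Matrix.PosSemidef.zero)).1.dotProduct_mulVec_nonneg c
    convert h using 1
    simp only [map_sum, map_smul, sum_inner, inner_sum, inner_smul_left, inner_smul_right,
      algMap_algTprod, inner_algTprod,
      dotProduct, Matrix.mulVec, Matrix.of_apply, Pi.star_apply, RCLike.star_def,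
      Finset.mul_sum]
    rw [Finset.sum_comm]
    exact Finset.sum_congr rfl fun k _ => Finset.sum_congr rfl fun l _ => by ring

end OpTensor

/-! ### Trace class operators and linearity of the trace. -/

section TraceClass

variable {K : Type u} [NormedAddCommGroup K] [InnerProductSpace ℂ K]

theorem IsTraceClass.smul {W : K →L[ℂ] K} (hW : IsTraceClass W) (c : ℂ) :
    IsTraceClass (c • W) := by
  obtain ⟨x, y, hs, h⟩ := hW
  refine ⟨fun k => c • x k, y, ?_, fun z => ?_⟩
  · simpa only [norm_smul, mul_assoc] using hs.mul_left ‖c‖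
  · simpa only [smul_comm c, smul_apply] using (h z).const_smul c

theorem IsTraceClass.add {A B : K →L[ℂ] K} (hA : IsTraceClass A) (hB : IsTraceClass B) :
    IsTraceClass (A + B) := by
  obtain ⟨x, y, hs, h⟩ := hA
  obtain ⟨x', y', hs', h'⟩ := hB
  refine ⟨Sum.elim x x' ∘ Equiv.natSumNatEquivNat.symm,
    Sum.elim y y' ∘ Equiv.natSumNatEquivNat.symm, ?_, fun z => ?_⟩
  · have hsum : Summable fun k : ℕ ⊕ ℕ => ‖Sum.elim x x' k‖ * ‖Sum.elim y y' k‖ :=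
      HasSum.summable (HasSum.sum (f := fun k : ℕ ⊕ ℕ => ‖Sum.elim x x' k‖ * ‖Sum.elim y y' k‖)
        hs.hasSum hs'.hasSum)
    exact hsum.comp_injective Equiv.natSumNatEquivNat.symm.injective
  · have hsum : HasSum (fun k : ℕ ⊕ ℕ => inner ℂ (Sum.elim y y' k) z • Sum.elim x x' k)
        (A z + B z) := by
      refine HasSum.sum ?_ ?_
      · simpa only [Function.comp_def, Sum.elim_inl] using h z
      · simpa only [Function.comp_def, Sum.elim_inr] using h' z
    rw [← Equiv.natSumNatEquivNat.symm.hasSum_iff] at hsum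
    simpa only [Function.comp_def, add_apply] using hsum

end TraceClass

section Trace

variable {K : Type u} [NormedAddCommGroup K] [InnerProductSpace ℂ K] [CompleteSpace K]

theorem IsTraceClass.hasSum_trace {W : K →L[ℂ] K} (hW : IsTraceClass W) :
    HasSum (fun i => inner ℂ ((exists_hilbertBasis ℂ K).choose_spec.choose i)
      (W ((exists_hilbertBasis ℂ K).choose_spec.choose i))) (trace W) := by
  obtain ⟨x, y, hs, h⟩ := hW
  exact (hasSum_inner_of_isTraceClass _ hs h).summable.hasSum

theorem trace_eq_tsum {W : K →L[ℂ] K} {x y : ℕ → K} (hs : Summable fun k => ‖x k‖ * ‖y k‖)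
    (hW : ∀ z, HasSum (fun k => inner ℂ (y k) z • x k) (W z)) :
    trace W = ∑' k, inner ℂ (y k) (x k) :=
  (hasSum_inner_of_isTraceClass _ hs hW).tsum_eq

theorem IsTraceClass.trace_add {A B : K →L[ℂ] K} (hA : IsTraceClass A) (hB : IsTraceClass B) :
    trace (A + B) = trace A + trace B := by
  have h := hA.hasSum_trace.add hB.hasSum_trace
  simp only [← inner_add_right] at h
  exact h.tsum_eq

theorem IsTraceClass.trace_sub {A B : K →L[ℂ] K} (hA : IsTraceClass A) (hB : IsTraceClass B) :
    trace (A - B) = trace A - trace B := by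
  have h := hA.hasSum_trace.sub hB.hasSum_trace
  simp only [← inner_sub_right] at h
  exact h.tsum_eq

theorem IsTraceClass.trace_smul {A : K →L[ℂ] K} (hA : IsTraceClass A) (c : ℂ) :
    trace (c • A) = c * trace A := by
  have h := hA.hasSum_trace.mul_left c
  simp only [← inner_smul_right] at h
  exact h.tsum_eq

/-- Precomposition by `A` turns `|x k⟩⟨y k|` into `|x k⟩⟨A* y k|`. -/
theorem hasSum_comp {W : K →L[ℂ] K} {x y : ℕ → K}
    (hW : ∀ z, HasSum (fun k => inner ℂ (y k) z • x k) (W z)) (A : K →L[ℂ] K) (z : K) :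
    HasSum (fun k => inner ℂ (ContinuousLinearMap.adjoint A (y k)) z • x k) ((W ∘L A) z) := by
  simpa [ContinuousLinearMap.adjoint_inner_left] using hW (A z)

theorem summable_norm_mul_norm_adjoint {x y : ℕ → K} (hs : Summable fun k => ‖x k‖ * ‖y k‖)
    (A : K →L[ℂ] K) : Summable fun k => ‖x k‖ * ‖ContinuousLinearMap.adjoint A (y k)‖ := by
  refine Summable.of_nonneg_of_le (fun k => by positivity) (fun k => ?_)
    (hs.mul_left ‖ContinuousLinearMap.adjoint A‖)
  calc ‖x k‖ * ‖ContinuousLinearMap.adjoint A (y k)‖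
      ≤ ‖x k‖ * (‖ContinuousLinearMap.adjoint A‖ * ‖y k‖) := by
        gcongr
        exact ContinuousLinearMap.le_opNorm _ _
    _ = _ := by ring

theorem IsTraceClass.comp {W : K →L[ℂ] K} (hW : IsTraceClass W) (A : K →L[ℂ] K) :
    IsTraceClass (W ∘L A) := by
  obtain ⟨x, y, hs, h⟩ := hW
  exact ⟨x, _, summable_norm_mul_norm_adjoint hs A, hasSum_comp h A⟩

end Trace

/-! ### The multilinear functional of a trace class operator. -/

section TraceFunctional

variable {ι : Type w} [Fintype ι]
variable {G : ι → Type u} [∀ i, NormedAddCommGroup (G i)] [∀ i, InnerProductSpace ℂ (G i)]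

/-- The multilinear functional `X ↦ tr[W (⨂ i, X i)]` of a trace class operator `W`. -/
noncomputable def traceFunctional (W : HilbertTensor G →L[ℂ] HilbertTensor G)
    (hW : IsTraceClass W) : MultilinearMap ℂ (fun i => G i →L[ℂ] G i) ℂ where
  toFun X := trace (W ∘L opTensor X)
  map_update_add' X i A B := by
    rw [opTensor_update_add, ContinuousLinearMap.comp_add, (hW.comp _).trace_add (hW.comp _)]
  map_update_smul' X i c A := by
    rw [opTensor_update_smul, ContinuousLinearMap.comp_smul, (hW.comp _).trace_smul, smul_eq_mul]

theorem traceFunctional_apply (W : HilbertTensor G →L[ℂ] HilbertTensor G) (hW : IsTraceClass W)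
    (X : ∀ i, G i →L[ℂ] G i) : traceFunctional W hW X = trace (W ∘L opTensor X) :=
  rfl

theorem traceFunctional_one (W : HilbertTensor G →L[ℂ] HilbertTensor G) (hW : IsTraceClass W) :
    traceFunctional W hW (fun _ => 1) = trace W := by
  rw [traceFunctional_apply, opTensor_one]
  rfl

end TraceFunctional

/-! ### Rank-one expansions and the existence of coverings. -/

theorem summable_norm_add_sq {K : Type u} [NormedAddCommGroup K] {x y : ℕ → K}
    (hx : Summable fun k => ‖x k‖ ^ 2) (hy : Summable fun k => ‖y k‖ ^ 2) : Summable fun k => ‖x k + y k‖ ^ 2 := by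
  refine Summable.of_nonneg_of_le (fun k => by positivity) (fun k => ?_)
    ((hx.add hy).mul_left 2)
  have h := norm_add_le (x k) (y k)
  nlinarith [norm_nonneg (x k + y k), sq_nonneg (‖x k‖ - ‖y k‖)]

section Covering

variable {K : Type u} [NormedAddCommGroup K] [InnerProductSpace ℂ K]

/-- A trace class operator is a sum `∑ k, |x k⟩⟨y k|` with `x` and `y` square summable. -/
theorem IsTraceClass.exists_sq_summable {W : K →L[ℂ] K} (hW : IsTraceClass W) :
    ∃ x y : ℕ → K, (Summable fun k => ‖x k‖ ^ 2) ∧ (Summable fun k => ‖y k‖ ^ 2) ∧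
      ∀ z, HasSum (fun k => inner ℂ (y k) z • x k) (W z) := by
  obtain ⟨x, y, hs, h⟩ := hW
  have key : ∀ a b : K, ∃ a' b' : K, ‖a'‖ ^ 2 = ‖a‖ * ‖b‖ ∧ ‖b'‖ ^ 2 = ‖a‖ * ‖b‖ ∧
      ∀ z, inner ℂ b' z • a' = inner ℂ b z • a := by
    intro a b
    rcases eq_or_ne a 0 with rfl | ha
    · exact ⟨0, 0, by simp⟩
    rcases eq_or_ne b 0 with rfl | hb
    · exact ⟨0, 0, by simp⟩
    have ha' := norm_pos_iff.2 ha
    have hb' := norm_pos_iff.2 hb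
    -- Scaling `a` by `r` and `b` by `r⁻¹` preserves `|a⟩⟨b|`; this `r` makes the two norms equal.
    have hr : 0 < √(‖b‖ / ‖a‖) := Real.sqrt_pos.2 (by positivity)
    have hr2 : √(‖b‖ / ‖a‖) ^ 2 = ‖b‖ / ‖a‖ := Real.sq_sqrt (by positivity)
    generalize √(‖b‖ / ‖a‖) = r at hr hr2
    refine ⟨(r : ℂ) • a, ((r⁻¹ : ℝ) : ℂ) • b, ?_, ?_, fun z => ?_⟩
    · rw [norm_smul, mul_pow, Complex.norm_real, Real.norm_of_nonneg hr.le, hr2]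
      field_simp
    · rw [norm_smul, mul_pow, Complex.norm_real, Real.norm_of_nonneg (by positivity), inv_pow, hr2]
      field_simp
    · have hrc : (r : ℂ) ≠ 0 := by exact_mod_cast hr.ne'
      rw [inner_smul_left, smul_smul, Complex.conj_ofReal, Complex.ofReal_inv]
      congr 1
      field_simp
  choose f g hf hg hfg using fun k => key (x k) (y k)
  refine ⟨f, g, ?_, ?_, fun z => ?_⟩
  · simpa only [hf] using hs
  · simpa only [hg] using hs
  · simpa only [hfg] using h z

variable [CompleteSpace K]

/-- The series `∑ k, |x k⟩⟨y k|` defines a bounded operator. -/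
theorem exists_clm_hasSum {x y : ℕ → K} (hs : Summable fun k => ‖x k‖ * ‖y k‖) :
    ∃ W : K →L[ℂ] K, ∀ z, HasSum (fun k => inner ℂ (y k) z • x k) (W z) := by
  have hn : Summable fun k => (innerSL ℂ (y k)).smulRight (x k) := by
    refine Summable.of_norm ?_
    simpa only [ContinuousLinearMap.norm_smulRight_apply, innerSL_apply_norm, mul_comm] using hs
  refine ⟨∑' k, (innerSL ℂ (y k)).smulRight (x k), fun z => ?_⟩
  simpa using hn.hasSum.mapL (ContinuousLinearMap.apply ℂ K z)

/-- Taking adjoints swaps `x` and `y`, and `T` is its own adjoint. The two expansions together make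
`T` symmetric in `x` and `y`, as polarization needs. -/
theorem hasSum_of_isSelfAdjoint {T : K →L[ℂ] K} (hT : IsSelfAdjoint T) {x y : ℕ → K}
    (hs : Summable fun k => ‖x k‖ * ‖y k‖)
    (h : ∀ z, HasSum (fun k => inner ℂ (y k) z • x k) (T z)) (z : K) :
    HasSum (fun k => inner ℂ (x k) z • y k) (T z) := by
  obtain ⟨W, hW⟩ := exists_clm_hasSum (x := y) (y := x) (by simpa only [mul_comm] using hs)
  have e : W z = T z := by
    refine ext_inner_left ℂ fun v => ?_
    have h1 := (innerSL ℂ v).hasSum (hW z)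
    have h2 := (innerSL ℂ z).hasSum (h v)
    have h3 := h2.star
    simp only [innerSL_apply_apply, inner_smul_right, RCLike.star_def, map_mul,
      inner_conj_symm] at h1 h3
    have h4 : inner ℂ v (W z) = inner ℂ (T v) z := by
      refine h1.unique ?_
      simpa only [mul_comm] using h3
    rw [h4]
    exact hT.isSymmetric v z
  exact e ▸ hW z

theorem exists_clm_sq {u : ℕ → K} (hu : Summable fun k => ‖u k‖ ^ 2) :
    ∃ P : K →L[ℂ] K, ∀ z, HasSum (fun k => inner ℂ (u k) z • u k) (P z) :=
  exists_clm_hasSum (by simpa only [sq] using hu)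

end Covering

section TensorPositive

variable {ι : Type w} [Fintype ι]
variable {G : ι → Type u} [∀ i, NormedAddCommGroup (G i)] [∀ i, InnerProductSpace ℂ (G i)]

theorem IsTensorPositive.half {W : HilbertTensor G →L[ℂ] HilbertTensor G}
    (hW : IsTensorPositive W) : IsTensorPositive ((1 / 2 : ℂ) • W) := by
  refine ⟨hW.1.smul _, fun X hX => ?_⟩
  rw [ContinuousLinearMap.smul_comp, (hW.1.comp _).trace_smul]
  refine mul_nonneg ?_ (hW.2 X hX)
  rw [Complex.nonneg_iff]
  norm_num

theorem IsTensorPositive.add {A B : HilbertTensor G →L[ℂ] HilbertTensor G}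
    (hA : IsTensorPositive A) (hB : IsTensorPositive B) : IsTensorPositive (A + B) := by
  refine ⟨hA.1.add hB.1, fun X hX => ?_⟩
  rw [ContinuousLinearMap.add_comp, (hA.1.comp _).trace_add (hB.1.comp _)]
  exact add_nonneg (hA.2 X hX) (hB.2 X hX)

variable [∀ i, CompleteSpace (G i)]

/-- The trace against `⨂ i, X i` is `∑ k, ⟪u k, (⨂ i, X i) u k⟫`, a sum of nonnegative terms. -/
theorem isTensorPositive_of_hasSum {P : HilbertTensor G →L[ℂ] HilbertTensor G}
    {u : ℕ → HilbertTensor G} (hu : Summable fun k => ‖u k‖ ^ 2)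
    (hP : ∀ z, HasSum (fun k => inner ℂ (u k) z • u k) (P z)) : IsTensorPositive P := by
  have hs : Summable fun k => ‖u k‖ * ‖u k‖ := by simpa only [sq] using hu
  refine ⟨⟨u, u, hs, hP⟩, fun X hX => ?_⟩
  rw [trace_eq_tsum (summable_norm_mul_norm_adjoint hs _) (hasSum_comp hP _)]
  refine tsum_nonneg fun k => ?_
  rw [ContinuousLinearMap.adjoint_inner_left]
  exact inner_opTensor_self_nonneg X hX (u k)

/-- Every self-adjoint trace class operator has a trace class covering. -/
theorem exists_isCovering {T : HilbertTensor G →L[ℂ] HilbertTensor G} (hT : IsSelfAdjoint T)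
    (hT' : IsTraceClass T) : ∃ V, IsCovering T V := by
  obtain ⟨x, y, hx, hy, h⟩ := hT'.exists_sq_summable
  have hs : Summable fun k => ‖x k‖ * ‖y k‖ := by
    refine Summable.of_nonneg_of_le (fun k => by positivity) (fun k => ?_) (hx.add hy)
    nlinarith [sq_nonneg (‖x k‖ - ‖y k‖), norm_nonneg (x k), norm_nonneg (y k)]
  have h' := hasSum_of_isSelfAdjoint hT hs h
  have hadd := summable_norm_add_sq hx hy
  have hsub := summable_norm_add_sq hx (y := fun k => - y k) (by simpa only [norm_neg] using hy)
  obtain ⟨Px, hPx⟩ := exists_clm_sq hx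
  obtain ⟨Py, hPy⟩ := exists_clm_sq hy
  obtain ⟨Pa, hPa⟩ := exists_clm_sq hadd
  obtain ⟨Ps, hPs⟩ := exists_clm_sq hsub
  -- Since `2 T = ∑ k, (|x k⟩⟨y k| + |y k⟩⟨x k|)`, adding `±T` to this operator completes the
  -- squares: the result is half of `∑ k, |x k ± y k⟩⟨x k ± y k|`.
  refine ⟨(1 / 2 : ℂ) • (Px + Py), ((isTensorPositive_of_hasSum hx hPx).add
    (isTensorPositive_of_hasSum hy hPy)).half, ?_, ?_⟩
  · have e : (1 / 2 : ℂ) • (Px + Py) + T = (1 / 2 : ℂ) • Pa := by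
      ext1 z
      have e1 : Pa z = (Px z + Py z) + (T z + T z) := by
        refine (hPa z).unique (((((hPx z).add (hPy z)).add ((h z).add (h' z)))).congr_fun ?_)
        intro k
        simp only [inner_add_left]
        module
      simp only [add_apply, smul_apply, e1]
      module
    rw [e]
    exact (isTensorPositive_of_hasSum hadd hPa).half
  · have e : (1 / 2 : ℂ) • (Px + Py) - T = (1 / 2 : ℂ) • Ps := by
      ext1 z
      have e1 : Ps z = (Px z + Py z) - (T z + T z) := by
        refine (hPs z).unique (((((hPx z).add (hPy z)).sub ((h z).add (h' z)))).congr_fun ?_)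
        intro k
        simp only [inner_add_left, inner_neg_left]
        module
      simp only [add_apply, sub_apply, smul_apply, e1]
      module
    rw [e]
    exact (isTensorPositive_of_hasSum hsub hPs).half

end TensorPositive

/-! ### Nonnegative weights with common marginals. -/

section Marginals

variable {D : Type*} [Fintype D] [DecidableEq D] {L : D → Type*} [∀ i, Fintype (L i)]

/-- Exchanging coordinate `i` of `x` with `a` is an involution on the pairs `(x, a)`. -/
theorem sum_sum_update (i : D) (F : (∀ i, L i) → ℝ) :
    ∑ x, ∑ a, F (Function.update x i a) = Fintype.card (L i) * ∑ x, F x := by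
  have hinv : Function.Involutive fun q : (∀ i, L i) × L i => (Function.update q.1 i q.2, q.1 i) :=
    fun q => by simp
  have h := Equiv.sum_comp hinv.toPerm fun q => F q.1
  rw [Fintype.sum_prod_type, Fintype.sum_prod_type] at h
  simpa [Finset.mul_sum] using h

/-- A function constant in coordinate `i` sees a weight only through its marginal on the other
coordinates. -/
theorem sum_mul_eq_of_marginal_eq (i : D) [Nonempty (L i)] {h p q : (∀ i, L i) → ℝ}
    (hh : ∀ x a, h (Function.update x i a) = h x)
    (hpq : ∀ x, ∑ a, p (Function.update x i a) = ∑ a, q (Function.update x i a)) :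
    ∑ x, h x * p x = ∑ x, h x * q x := by
  have hc : (Fintype.card (L i) : ℝ) ≠ 0 := by exact_mod_cast Fintype.card_ne_zero
  refine mul_left_cancel₀ hc ?_
  rw [← sum_sum_update i fun x => h x * p x, ← sum_sum_update i fun x => h x * q x]
  simp only [hh, ← Finset.mul_sum, hpq]

end Marginals

/-- A family of nonnegative quasi-joint distributions of the outcomes of all measurements, one for
each setting at site `n` and with common marginals away from site `n`, obeys the LHV bounds. -/
theorem sum_mul_le_of_marginal_eq {N : ℕ} {S R : Fin N → ℕ} [∀ m, Nonempty (Fin (S m))]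
    {Λ : Fin N → Type v} [∀ m, Fintype (Λ m)] [∀ m, Nonempty (Λ m)]
    {ψ : (∀ m, Fin (S m)) → (∀ m, Λ m) → ℝ} {B : ℝ}
    (hB : ∀ l : ∀ m, Fin (S m) → Λ m, ∑ s, ψ s (fun m => l m (s m)) ≤ B)
    (n : Fin N) (j : Fin (R n)) (κ : ∀ m, Fin (S m) → Fin (R m))
    {p : Fin (S n) → (∀ i : (m : Fin N) × Fin (R m), Λ i.1) → ℝ} (hp : ∀ t x, 0 ≤ p t x)
    (hmarg : ∀ t t' x, ∑ a, p t (Function.update x ⟨n, j⟩ a) =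
      ∑ a, p t' (Function.update x ⟨n, j⟩ a))
    {c : ℝ} (hc : ∀ t, ∑ x, p t x = c) :
    ∑ s, ∑ x, ψ s (fun m => x ⟨m, κ m (s m)⟩) * p (s n) x ≤ B * c := by
  classical
  -- `φ t` collects the terms with setting `t` at site `n`; `Φ t` below is its maximum over the
  -- outcome at `⟨n, j⟩`, hence independent of that coordinate.
  let φ : Fin (S n) → (∀ i : (m : Fin N) × Fin (R m), Λ i.1) → ℝ := fun t x =>
    ∑ s with s n = t, ψ s fun m => x ⟨m, κ m (s m)⟩
  have hmax : ∀ t x, ∃ a : Λ n, ∀ b : Λ n,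
      φ t (Function.update x ⟨n, j⟩ b) ≤ φ t (Function.update x ⟨n, j⟩ a) := fun t x =>
    Finite.exists_max fun a : Λ n => φ t (Function.update x ⟨n, j⟩ a)
  choose a ha using hmax
  let Φ : Fin (S n) → (∀ i : (m : Fin N) × Fin (R m), Λ i.1) → ℝ := fun t x =>
    φ t (Function.update x ⟨n, j⟩ (a t x))
  have hφΦ : ∀ t x, φ t x ≤ Φ t x := fun t x => by
    simpa using ha t x (x ⟨n, j⟩)
  have hΦ : ∀ t x b, Φ t (Function.update x ⟨n, j⟩ b) = Φ t x := fun t x b => by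
    refine le_antisymm ?_ ?_
    · have := ha t x (a t (Function.update x ⟨n, j⟩ b))
      simpa [Φ] using this
    · have := ha t (Function.update x ⟨n, j⟩ b) (a t x)
      simpa [Φ] using this
  obtain ⟨t₀⟩ : Nonempty (Fin (S n)) := inferInstance
  have hlhv : ∀ x, ∑ t, Φ t x ≤ B := by
    intro x
    -- Only a typing device: `Function.update s₀ m r n` is `r` when `m = n`, and for other `m` its
    -- value is never read. The strategy `l` replies to setting `t` at site `n` with the maximizer
    -- and reads the other outcomes off `x`.
    let s₀ : ∀ m, Fin (S m) := fun m => Classical.arbitrary _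
    let l : ∀ m, Fin (S m) → Λ m := fun m r =>
      Function.update x ⟨n, j⟩ (a (Function.update s₀ m r n) x) ⟨m, κ m r⟩
    refine le_trans (le_of_eq ?_) (hB l)
    rw [← Finset.sum_fiberwise Finset.univ fun s : ∀ m, Fin (S m) => s n]
    refine Finset.sum_congr rfl fun t _ => Finset.sum_congr rfl fun s hs => ?_
    obtain rfl : s n = t := by simpa using hs
    congr 1
    funext m
    by_cases hm : m = n
    · subst hm
      simp [l]
    · have hne : (⟨m, κ m (s m)⟩ : (m : Fin N) × Fin (R m)) ≠ ⟨n, j⟩ := fun h =>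
        hm (congrArg Sigma.fst h)
      simp [l, Function.update_of_ne hne]
  calc ∑ s, ∑ x, ψ s (fun m => x ⟨m, κ m (s m)⟩) * p (s n) x
      = ∑ t, ∑ x, φ t x * p t x := by
        rw [← Finset.sum_fiberwise Finset.univ fun s : ∀ m, Fin (S m) => s n]
        refine Finset.sum_congr rfl fun t _ => ?_
        rw [Finset.sum_comm]
        refine Finset.sum_congr rfl fun x _ => ?_
        rw [Finset.sum_mul]
        refine Finset.sum_congr rfl fun s hs => ?_
        obtain rfl : s n = t := by simpa using hs
        rfl
    _ ≤ ∑ t, ∑ x, Φ t x * p t x := by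
        gcongr with t _ x _
        · exact hp t x
        · exact hφΦ t x
    -- As `Φ t` ignores the outcome at `⟨n, j⟩`, all the `p t` may be replaced by one fixed `p t₀`.
    _ = ∑ t, ∑ x, Φ t x * p t₀ x := by
        refine Finset.sum_congr rfl fun t _ => ?_
        have : Nonempty (Λ (⟨n, j⟩ : (m : Fin N) × Fin (R m)).1) :=
          inferInstanceAs (Nonempty (Λ n))
        exact sum_mul_eq_of_marginal_eq (L := fun i : (m : Fin N) × Fin (R m) => Λ i.1)
          ⟨n, j⟩ (hΦ t) (hmarg t t₀)
    _ = ∑ x, (∑ t, Φ t x) * p t₀ x := by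
        rw [Finset.sum_comm]
        exact Finset.sum_congr rfl fun x _ => (Finset.sum_mul _ _ _).symm
    _ ≤ ∑ x, B * p t₀ x := by
        gcongr with x _
        · exact hp t₀ x
        · exact hlhv x
    _ = B * c := by rw [← Finset.mul_sum, hc]

theorem lhvBound_nonneg {N : ℕ} {S : Fin N → ℕ} {Λ : Fin N → Type v}
    (ψ : (∀ n, Fin (S n)) → (∀ n, Λ n) → ℝ) : 0 ≤ lhvBound ψ :=
  (abs_nonneg _).trans (le_max_left _ _)

/-! ### Bell violations: the lower bound and the bound by coverings. -/

section Violation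

variable {N : ℕ} {H : Fin N → Type u} [∀ n, NormedAddCommGroup (H n)]
  [∀ n, InnerProductSpace ℂ (H n)] [∀ n, CompleteSpace (H n)]
  {S R : Fin N → ℕ} {Λ : Fin N → Type v} [∀ n, Fintype (Λ n)]

theorem sum_jointProb {ρ : HilbertTensor H →L[ℂ] HilbertTensor H} (hρ : IsState ρ)
    (M : ∀ n, Fin (S n) → POVM (H n) (Λ n)) (s : ∀ n, Fin (S n)) :
    ∑ l, jointProb ρ M s l = 1 := by
  classical
  obtain ⟨-, hρ, hρ1⟩ := hρ
  have h := (traceFunctional ρ hρ).map_sum fun n (a : Λ n) => (M n (s n)).effect a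
  simp only [POVM.sum_effect] at h
  rw [traceFunctional_one, hρ1] at h
  simp only [traceFunctional_apply] at h
  simp only [jointProb, ← Complex.re_sum, ← h, Complex.one_re]

theorem nonempty_povm (E : Type u) [NormedAddCommGroup E] [InnerProductSpace ℂ E] [CompleteSpace E]
    (L : Type v) [Fintype L] [Nonempty L] : Nonempty (POVM E L) := by
  classical
  obtain ⟨a⟩ : Nonempty L := inferInstance
  refine ⟨⟨fun b => if b = a then 1 else 0, fun b => ?_, by simp⟩⟩
  split_ifs
  · exact ContinuousLinearMap.isPositive_one
  · exact ContinuousLinearMap.isPositive_zero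

theorem one_le_maxBellViolation [∀ n, Nonempty (Λ n)]
    {ρ : HilbertTensor H →L[ℂ] HilbertTensor H} (hρ : IsState ρ) (hS : ∀ n, 1 ≤ S n) :
    1 ≤ maxBellViolation ρ S Λ := by
  have : ∀ n, Nonempty (Fin (S n)) := fun n => ⟨⟨0, hS n⟩⟩
  have M : ∀ n, Fin (S n) → POVM (H n) (Λ n) := fun n _ => (nonempty_povm (H n) (Λ n)).some
  let ψ : (∀ n, Fin (S n)) → (∀ n, Λ n) → ℝ := fun _ _ => 1
  have hc : 0 < (Fintype.card (∀ n, Fin (S n)) : ℝ) := by exact_mod_cast Fintype.card_pos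
  have hB : lhvBound ψ = Fintype.card (∀ n, Fin (S n)) := by
    simp [lhvBound, lhvSup, lhvInf, ψ, Finset.prod_nonneg]
  have hQ : quantumValue ρ M ψ = Fintype.card (∀ n, Fin (S n)) := by
    simp only [quantumValue, ψ, one_mul, sum_jointProb hρ]
    simp
  refine le_trans ?_ (le_iSup₂_of_le M ψ (le_iSup_of_le (by rw [hB]; exact hc.ne') le_rfl))
  rw [hB, hQ, abs_of_pos hc, div_self hc.ne', ENNReal.ofReal_one]

theorem abs_sum_le_lhvBound (ψ : (∀ n, Fin (S n)) → (∀ n, Λ n) → ℝ) (l : ∀ n, Fin (S n) → Λ n) :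
    |∑ s, ψ s fun n => l n (s n)| ≤ lhvBound ψ := by
  have h1 : ∑ s, ψ s (fun n => l n (s n)) ≤ lhvSup ψ :=
    le_ciSup (f := fun l : ∀ n, Fin (S n) → Λ n => ∑ s, ψ s fun n => l n (s n))
      (Set.finite_range _).bddAbove l
  have h2 : lhvInf ψ ≤ ∑ s, ψ s (fun n => l n (s n)) :=
    ciInf_le (f := fun l : ∀ n, Fin (S n) → Λ n => ∑ s, ψ s fun n => l n (s n))
      (Set.finite_range _).bddBelow l
  refine abs_le.2 ⟨?_, h1.trans ((le_abs_self _).trans (le_max_left _ _))⟩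
  have h3 := neg_abs_le (lhvInf ψ)
  have h4 : |lhvInf ψ| ≤ lhvBound ψ := le_max_right _ _
  linarith

/-- The value of `W` on the product of the effects with outcomes `x`, where the measurement made on
the copy `i` has the setting `c i`. -/
noncomputable def copyProb (W : CopiesTensor H R →L[ℂ] CopiesTensor H R)
    (M : ∀ n, Fin (S n) → POVM (H n) (Λ n)) (c : ∀ i : (m : Fin N) × Fin (R m), Fin (S i.1))
    (x : ∀ i : (m : Fin N) × Fin (R m), Λ i.1) : ℝ :=
  (trace (W ∘L opTensor fun i => (M i.1 (c i)).effect (x i))).re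

theorem copyProb_nonneg {W : CopiesTensor H R →L[ℂ] CopiesTensor H R} (hW : IsTensorPositive W)
    (M : ∀ n, Fin (S n) → POVM (H n) (Λ n)) (c : ∀ i : (m : Fin N) × Fin (R m), Fin (S i.1))
    (x : ∀ i : (m : Fin N) × Fin (R m), Λ i.1) : 0 ≤ copyProb W M c x :=
  (Complex.nonneg_iff.1 (hW.2 _ fun i => (M i.1 (c i)).isPositive (x i))).1

theorem sum_copyProb {W : CopiesTensor H R →L[ℂ] CopiesTensor H R} (hW : IsTraceClass W)
    (M : ∀ n, Fin (S n) → POVM (H n) (Λ n)) (c : ∀ i : (m : Fin N) × Fin (R m), Fin (S i.1)) :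
    ∑ x, copyProb W M c x = (trace W).re := by
  classical
  have h := (traceFunctional W hW).map_sum fun i (a : Λ i.1) => (M i.1 (c i)).effect a
  simp only [POVM.sum_effect] at h
  rw [traceFunctional_one] at h
  simp only [traceFunctional_apply] at h
  simp only [copyProb, ← Complex.re_sum, ← h]

/-- No signalling: summing over the outcomes at copy `k` puts the identity there, whichever
measurement was made. -/
theorem sum_copyProb_update {W : CopiesTensor H R →L[ℂ] CopiesTensor H R} (hW : IsTraceClass W)
    (M : ∀ n, Fin (S n) → POVM (H n) (Λ n)) (c c' : ∀ i : (m : Fin N) × Fin (R m), Fin (S i.1))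
    (k : (m : Fin N) × Fin (R m)) (hc : ∀ i, i ≠ k → c i = c' i)
    (x : ∀ i : (m : Fin N) × Fin (R m), Λ i.1) :
    ∑ a, copyProb W M c (Function.update x k a) =
      ∑ a, copyProb W M c' (Function.update x k a) := by
  have key : ∀ c : ∀ i : (m : Fin N) × Fin (R m), Fin (S i.1),
      ∑ a, copyProb W M c (Function.update x k a) =
        (traceFunctional W hW (Function.update (fun i => (M i.1 (c i)).effect (x i)) k 1)).re := by
    intro c
    rw [← (M k.1 (c k)).sum_effect, MultilinearMap.map_update_sum, Complex.re_sum]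
    refine Finset.sum_congr rfl fun a _ => ?_
    rw [traceFunctional_apply, copyProb]
    congr 4
    funext i
    by_cases h : i = k
    · subst h; simp
    · simp [h]
  rw [key, key]
  congr 2
  funext i
  by_cases h : i = k
  · subst h; simp
  · simp [h, hc i h]

/-- The outcomes at the selected copies have the joint distribution of the scenario on `ρ`. -/
theorem sum_mul_jointProb {ρ : HilbertTensor H →L[ℂ] HilbertTensor H}
    {T : CopiesTensor H R →L[ℂ] CopiesTensor H R} (hT : IsSourceOperator ρ R T)
    (M : ∀ n, Fin (S n) → POVM (H n) (Λ n)) (c : ∀ i : (m : Fin N) × Fin (R m), Fin (S i.1))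
    (s : ∀ n, Fin (S n)) (k : ∀ n, Fin (R n)) (hc : ∀ n, c ⟨n, k n⟩ = s n)
    (g : (∀ n, Λ n) → ℝ) :
    ∑ l, g l * jointProb ρ M s l = ∑ x, g (fun n => x ⟨n, k n⟩) * copyProb T M c x := by
  classical
  rw [← Finset.sum_fiberwise Finset.univ
    fun x : ∀ i : (m : Fin N) × Fin (R m), Λ i.1 => fun n => x ⟨n, k n⟩]
  refine Finset.sum_congr rfl fun l _ => ?_
  have hj : jointProb ρ M s l =
      ∑ x with (fun n => x ⟨n, k n⟩) = l, copyProb T M c x := by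
    rw [jointProb, ← hT.trace_eq k, ← traceFunctional_apply T hT.isTraceClass]
    -- The outcome is prescribed on the selected copies and free on the others, where the effects
    -- sum to `1`; expanding by multilinearity gives the marginal.
    let A : ∀ i : (m : Fin N) × Fin (R m), Finset (Λ i.1) := fun i =>
      if i.2 = k i.1 then {l i.1} else Finset.univ
    have h := (traceFunctional T hT.isTraceClass).map_sum_finset
      (fun i (a : Λ i.1) => (M i.1 (c i)).effect a) A
    have e : (fun i => ∑ a ∈ A i, (M i.1 (c i)).effect a) =
        fun i : (m : Fin N) × Fin (R m) => if i.2 = k i.1 then (M i.1 (s i.1)).effect (l i.1) else 1 := by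
      funext ⟨m, r⟩
      by_cases hr : r = k m
      · subst hr
        simp [A, hc]
      · simp [A, hr, POVM.sum_effect]
    rw [e] at h
    rw [h, Complex.re_sum]
    refine Finset.sum_congr ?_ fun x _ => rfl
    ext x
    simp only [Fintype.mem_piFinset, Finset.mem_filter_univ, A]
    refine ⟨fun hx => funext fun n => by simpa using hx ⟨n, k n⟩, ?_⟩
    rintro rfl ⟨m, r⟩
    by_cases hr : r = k m
    · subst hr; simp
    · simp [hr]
  rw [hj, Finset.mul_sum]
  refine Finset.sum_congr rfl fun x hx => ?_
  obtain rfl : (fun n => x ⟨n, k n⟩) = l := by simpa using hx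
  rfl

theorem copyProb_add_sub {T V : CopiesTensor H R →L[ℂ] CopiesTensor H R} (hT : IsTraceClass T)
    (hV : IsTraceClass V) (M : ∀ n, Fin (S n) → POVM (H n) (Λ n))
    (c : ∀ i : (m : Fin N) × Fin (R m), Fin (S i.1))
    (x : ∀ i : (m : Fin N) × Fin (R m), Λ i.1) :
    copyProb T M c x = (copyProb (V + T) M c x - copyProb (V - T) M c x) / 2 := by
  simp only [copyProb, ContinuousLinearMap.add_comp, ContinuousLinearMap.sub_comp,
    (hV.comp _).trace_add (hT.comp _), (hV.comp _).trace_sub (hT.comp _), Complex.add_re,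
    Complex.sub_re]
  ring

/-- Bell violations are bounded by the trace of any covering of a source operator with one setting
at some site. -/
theorem abs_quantumValue_le [∀ n, Nonempty (Λ n)] {ρ : HilbertTensor H →L[ℂ] HilbertTensor H}
    (hS : ∀ n, 1 ≤ S n) (n : Fin N) (hRn : R n = 1) (hR : ∀ m, m ≠ n → R m = S m)
    {T V : CopiesTensor H R →L[ℂ] CopiesTensor H R} (hT : IsSourceOperator ρ R T)
    (hV : IsCovering T V) (M : ∀ n, Fin (S n) → POVM (H n) (Λ n))
    (ψ : (∀ n, Fin (S n)) → (∀ n, Λ n) → ℝ) :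
    |quantumValue ρ M ψ| ≤ lhvBound ψ * (trace V).re := by
  have : ∀ m, Nonempty (Fin (S m)) := fun m => ⟨⟨0, hS m⟩⟩
  have hsub : Subsingleton (Fin (R n)) := by rw [hRn]; infer_instance
  let j : Fin (R n) := ⟨0, by omega⟩
  -- `κ m r` is the copy at site `m` that carries setting `r`. In `c t`, each copy away from `n` has
  -- its own index as setting, and the single copy at `n` has setting `t`.
  let κ : ∀ m, Fin (S m) → Fin (R m) := fun m r =>
    if h : m = n then ⟨0, by rw [h]; omega⟩ else Fin.cast (hR m h).symm r
  let c : Fin (S n) → ∀ i : (m : Fin N) × Fin (R m), Fin (S i.1) := fun t i =>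
    if h : i.1 = n then Fin.cast (by rw [h]) t else Fin.cast (hR i.1 h) i.2
  have hc : ∀ s : ∀ m, Fin (S m), ∀ m, c (s n) ⟨m, κ m (s m)⟩ = s m := by
    intro s m
    by_cases hm : m = n
    · subst hm; simp [c]
    · simp [c, κ, hm]
  have hcc : ∀ t t' i, i ≠ ⟨n, j⟩ → c t i = c t' i := by
    rintro t t' ⟨m, r⟩ hi
    by_cases hm : m = n
    · subst hm
      exact absurd (congrArg (Sigma.mk m) (Subsingleton.elim r j)) hi
    · simp [c, hm]
  have hQ : ∀ W, IsTensorPositive W → ∀ χ : (∀ n, Fin (S n)) → (∀ n, Λ n) → ℝ,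
      (∀ l : ∀ n, Fin (S n) → Λ n, ∑ s, χ s (fun n => l n (s n)) ≤ lhvBound ψ) →
      ∑ s, ∑ x, χ s (fun m => x ⟨m, κ m (s m)⟩) * copyProb W M (c (s n)) x ≤
        lhvBound ψ * (trace W).re := fun W hW χ hχ =>
    sum_mul_le_of_marginal_eq hχ n j κ
      (fun t x => copyProb_nonneg hW M (c t) x)
      (fun t t' x => sum_copyProb_update hW.1 M _ _ _ (hcc t t') x)
      (fun t => sum_copyProb hW.1 M (c t))
  have hψ : ∀ l : ∀ n, Fin (S n) → Λ n, ∑ s, ψ s (fun n => l n (s n)) ≤ lhvBound ψ := fun l =>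
    (le_abs_self _).trans (abs_sum_le_lhvBound ψ l)
  have hψ' : ∀ l : ∀ n, Fin (S n) → Λ n, ∑ s, (-ψ) s (fun n => l n (s n)) ≤ lhvBound ψ :=
    fun l => by
      refine le_trans ?_ (abs_sum_le_lhvBound ψ l)
      simpa using neg_le_abs (∑ s, ψ s fun n => l n (s n))
  have hqv : quantumValue ρ M ψ =
      (∑ s, ∑ x, ψ s (fun m => x ⟨m, κ m (s m)⟩) * copyProb (V + T) M (c (s n)) x -
        ∑ s, ∑ x, ψ s (fun m => x ⟨m, κ m (s m)⟩) * copyProb (V - T) M (c (s n)) x) / 2 := by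
    simp only [quantumValue, ← Finset.sum_sub_distrib, Finset.sum_div]
    refine Finset.sum_congr rfl fun s _ => ?_
    rw [sum_mul_jointProb hT M (c (s n)) s (fun m => κ m (s m)) (hc s)]
    refine Finset.sum_congr rfl fun x _ => ?_
    rw [copyProb_add_sub hT.isTraceClass hV.1.1]
    ring
  -- Both signs of `ψ` are needed for each of `V + T` and `V - T`, to bound the half-difference from
  -- above and below; the traces of `T` then cancel.
  have h1 := hQ _ hV.2.1 ψ hψ
  have h2 := hQ _ hV.2.2 ψ hψ
  have h3 := hQ _ hV.2.1 (-ψ) hψ'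
  have h4 := hQ _ hV.2.2 (-ψ) hψ'
  simp only [hV.1.1.trace_add hT.isTraceClass, hV.1.1.trace_sub hT.isTraceClass, Complex.add_re,
    Complex.sub_re, Pi.neg_apply, neg_mul, Finset.sum_neg_distrib] at h1 h2 h3 h4
  rw [hqv, abs_le]
  constructor <;> linarith

end Violation

end Bell

theorem theorem2 {N : ℕ} (H : Fin N → Type u) [∀ n, NormedAddCommGroup (H n)]
    [∀ n, InnerProductSpace ℂ (H n)] [∀ n, CompleteSpace (H n)]
    [∀ n, TopologicalSpace.SeparableSpace (H n)]
    (ρ : HilbertTensor H →L[ℂ] HilbertTensor H) (hρ : IsState ρ)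
    (S : Fin N → ℕ) (hS : ∀ n, 1 ≤ S n)
    (Λ : Fin N → Type v) [∀ n, Fintype (Λ n)] [∀ n, Nonempty (Λ n)] :
    1 ≤ maxBellViolation ρ S Λ ∧
      maxBellViolation ρ S Λ ≤
        ⨅ (n : Fin N)
          (T : CopiesTensor H (Function.update S n 1) →L[ℂ] CopiesTensor H (Function.update S n 1))
          (_ : IsSourceOperator ρ (Function.update S n 1) T),
          ENNReal.ofReal (coveringNorm T) := by
  refine ⟨one_le_maxBellViolation hρ hS, ?_⟩
  refine le_iInf₂ fun n T => le_iInf fun hT => iSup₂_le fun M ψ => iSup_le fun hψ => ?_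
  refine ENNReal.ofReal_le_ofReal ?_
  have hpos : 0 < lhvBound ψ := lt_of_le_of_ne (lhvBound_nonneg ψ) (Ne.symm hψ)
  -- Without a covering, `coveringNorm T` would be `sInf ∅ = 0` and the bound would be lost.
  obtain ⟨V₀, hV₀⟩ := exists_isCovering hT.isSelfAdjoint hT.isTraceClass
  refine le_csInf ⟨_, V₀, hV₀, rfl⟩ ?_
  rintro r ⟨V, hV, rfl⟩
  rw [div_le_iff₀' hpos]
  exact abs_quantumValue_le hS n (Function.update_self n 1 S)
    (fun m hm => Function.update_of_ne hm 1 S) hT hV M ψ
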